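/- Let $K$ be a field, $n$ a positive integer, $S=K[x_1,\dots,x_n]$, and let $G$ be a finite simple graph on the vertex set $[n]=\{1,\dots,n\}$ with at least one edge. Let $$I_c(G)=\big((x_1\cdots x_n)/(x_ix_j)\ :\ \{i,j\}\in E(G)\big)\subseteq S$$ be the complementary edge ideal of $G$. For $F\subseteq[n]$ put $P_F=(x_i: i\in F)\subseteq S$ and $S_F=K[x_i:i\in F]$, and for a monomial ideal $I\subseteq S$ let $I(P_F)\subseteq S_F$ be the monomial localization of $I$, that is, the image of $I$ under the $K$-algebra homomorphism $S\to S_F$ with $x_i\mapsto x_i$ for $i\in F$ and $x_j\mapsto 1$ for $j\notin F$. For $k\ge1$ the $k$-th symbolic power of a monomial ideal $I$ is $$I^{(k)}=\bigcap_{P_F\in\operatorname{Ass}(S/I)} I^k(P_F)\,S,$$ where $I^k(P_F)=(I^k)(P_F)$, and an empty intersection is $S$. The following conditions are equivalent. (a) $I_c(G)^k=I_c(G)^{(k)}$ for all $k\ge1$. (b) $I_c(G)^k=I_c(G)^{(k)}$ for some $k\ge2$. (c) $G$ is isomorphic to the disjoint union of one of the graphs $K_2$, $K_3$, $P_3$,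 $2K_2$, $P_4$, $C_4$ with a (possibly empty) set of isolated vertices. Here $K_m$, $P_m$ and $C_m$ are the complete graph, the path and the cycle on $m$ vertices, and $2K_2$ is the disjoint union of two copies of $K_2$. -/

import Mathlib

open SimpleGraph

noncomputable section

namespace ComplementaryEdgeIdeal

variable {K : Type*} [Field K] {n : ℕ}

/-- The complementary edge ideal `I_c(G)` of a graph `G` on `[n]`: the ideal of `K[x_1, …, x_n]`
generated by the monomials `(x_1 ⋯ x_n) / (x_i x_j)` for the edges `{i, j}` of `G`. -/
def complementaryEdgeIdeal (K : Type*) [Field K] {n : ℕ} (G : SimpleGraph (Fin n)) :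
    Ideal (MvPolynomial (Fin n) K) :=
  Ideal.span {u | ∃ i j : Fin n, G.Adj i j ∧
    u = ∏ l ∈ Finset.univ \ ({i, j} : Finset (Fin n)), MvPolynomial.X l}

/-- The monomial prime ideal `P_F = (x_i : i ∈ F)`. -/
def monomialPrime (K : Type*) [Field K] {n : ℕ} (F : Finset (Fin n)) :
    Ideal (MvPolynomial (Fin n) K) :=
  Ideal.span {f | ∃ i ∈ F, f = MvPolynomial.X i}

/-- The substitution `φ_F : S → S_F = K[x_i : i ∈ F]` with `x_i ↦ x_i` for `i ∈ F` and
`x_j ↦ 1` for `j ∉ F`. -/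
def localizationMap (K : Type*) [Field K] {n : ℕ} (F : Finset (Fin n)) :
    MvPolynomial (Fin n) K →ₐ[K] MvPolynomial {i : Fin n // i ∈ F} K :=
  MvPolynomial.aeval fun i => if h : i ∈ F then MvPolynomial.X ⟨i, h⟩ else 1

/-- The monomial localization `I(P_F) = φ_F(I)`, an ideal of `S_F` (as `φ_F` is surjective, the
image of an ideal is the ideal that it generates). -/
def monomialLocalization (I : Ideal (MvPolynomial (Fin n) K)) (F : Finset (Fin n)) :
    Ideal (MvPolynomial {i : Fin n // i ∈ F} K) :=
  I.map (localizationMap K F)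

/-- The extension to `S` of an ideal of `S_F`, along the inclusion of `S_F` in `S`. -/
def extendIdeal (F : Finset (Fin n)) (J : Ideal (MvPolynomial {i : Fin n // i ∈ F} K)) :
    Ideal (MvPolynomial (Fin n) K) :=
  J.map (MvPolynomial.rename (R := K) (Subtype.val : {i : Fin n // i ∈ F} → Fin n))

/-- The `k`-th symbolic power of a monomial ideal `I`: the intersection of the ideals
`I^k(P_F) S` over the sets `F` such that `P_F` is an associated prime of `S / I`. -/
def symbolicPower (I : Ideal (MvPolynomial (Fin n) K)) (k : ℕ) :
    Ideal (MvPolynomial (Fin n) K) :=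
  ⨅ F ∈ {F : Finset (Fin n) | monomialPrime K F ∈
      associatedPrimes (MvPolynomial (Fin n) K) (MvPolynomial (Fin n) K ⧸ I)},
    extendIdeal F (monomialLocalization (I ^ k) F)

/-- `G` is isomorphic to `H` with (possibly) some isolated vertices added. -/
def IsoUpToIsolated {V W : Type*} (G : SimpleGraph V) (H : SimpleGraph W) : Prop :=
  ∃ m : ℕ, Nonempty (G ≃g (H ⊕g (⊥ : SimpleGraph (Fin m))))

end ComplementaryEdgeIdeal

end

/-!
Write `I = I_c(G)`. Equality of ordinary and symbolic powers reduces to a question about integer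
vectors. The associated primes of the squarefree monomial ideal `I` are the `P_F` for the minimal
nonfaces `F` of `G`: the isolated vertices, the pairs of non-isolated non-adjacent vertices and the
triangles. Localizing `I` at such a prime gives `P_F` itself, so the `k`-th symbolic power is the
intersection of the `P_F ^ k`. It is spanned by the monomials `x ^ a` such that the entries of `a`
over each minimal nonface sum to at least `k` (`pow_eq_symbolicPower_iff`). Such a monomial lies in
`I ^ k` if and only if there are `k` edges, with repetition, such that each vertex `l` is avoided by
at most `a l` of them.

For the six exceptional graphs the multiplicities of the edges are found by solving the inequalities
(`pow_eq_symbolicPower_of_exceptional`).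

Conversely, three configurations give, for every `k ≥ 2`, a monomial of the symbolic power outside
`I ^ k`: five non-isolated vertices, a triangle one of whose vertices has a neighbour off the
triangle, and three independent non-isolated vertices. In each case let `T` be the set of vertices
of the configuration. If every edge avoids at least `r` vertices of `T`, then the monomials of
`I ^ k` have degree at least `k * r` in the variables of `T` (`pow_ne_symbolicPower`); here `r` is
`|T| - 2` or, for an independent set, `|T| - 1`. Exponents close to `k / 2` on `T` violate this
bound. The graphs that contain none of the three configurations are the exceptional ones
(`exceptional_of_no_obstruction`).
-/

namespace ComplementaryEdgeIdeal

open MvPolynomial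

/-! ### Monomial ideals -/

/-- The ideal of the polynomials all of whose monomials have degree at least `N` in the variables
indexed by `T`; it equals `P_T ^ N`. -/
noncomputable def degreeIdeal (K : Type*) [Field K] {n : ℕ} (T : Finset (Fin n)) (N : ℕ) :
    Ideal (MvPolynomial (Fin n) K) :=
  restrictSupportIdeal K {a | N ≤ ∑ i ∈ T, a i}
    (fun _ _ hab ha => le_trans ha (Finset.sum_le_sum fun i _ => hab i))

section

variable {K : Type*} [Field K] {n : ℕ}

theorem mem_degreeIdeal {T : Finset (Fin n)} {N : ℕ} {f : MvPolynomial (Fin n) K} :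
    f ∈ degreeIdeal K T N ↔ ∀ m ∈ f.support, N ≤ ∑ i ∈ T, m i := by
  change f ∈ restrictSupport K _ ↔ _
  simp [mem_restrictSupport_iff, Set.subset_def]

theorem monomial_mem_degreeIdeal {T : Finset (Fin n)} {N : ℕ} {a : Fin n →₀ ℕ} :
    monomial a (1 : K) ∈ degreeIdeal K T N ↔ N ≤ ∑ i ∈ T, a i := by
  classical
  simp [mem_degreeIdeal, support_monomial]

theorem degreeIdeal_mul_le (T : Finset (Fin n)) (N M : ℕ) :
    degreeIdeal K T N * degreeIdeal K T M ≤ degreeIdeal K T (N + M) := by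
  classical
  rw [Ideal.mul_le]
  intro f hf g hg
  rw [mem_degreeIdeal] at *
  intro m hm
  obtain ⟨a, ha, b, hb, rfl⟩ := Finset.mem_add.1 (support_mul f g hm)
  simpa [Finset.sum_add_distrib] using add_le_add (hf a ha) (hg b hb)

theorem degreeIdeal_pow_le (T : Finset (Fin n)) (N k : ℕ) :
    degreeIdeal K T N ^ k ≤ degreeIdeal K T (k * N) := by
  induction k with
  | zero => intro f _; simp [mem_degreeIdeal]
  | succ k ih =>
    rw [pow_succ, Nat.succ_mul]
    exact (Ideal.mul_mono_left ih).trans (degreeIdeal_mul_le T _ _)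

theorem prod_X_eq_monomial (s : Finset (Fin n)) :
    ∏ l ∈ s, (X l : MvPolynomial (Fin n) K) = monomial (∑ l ∈ s, Finsupp.single l 1) 1 := by
  rw [monomial_sum_one]; rfl

theorem sum_single_apply (s : Finset (Fin n)) (l : Fin n) :
    (∑ i ∈ s, Finsupp.single i 1 : Fin n →₀ ℕ) l = if l ∈ s then 1 else 0 := by
  simp [Finsupp.finsetSum_apply, Finsupp.single_apply]

theorem sum_single_le_iff (s : Finset (Fin n)) (m : Fin n →₀ ℕ) :
    (∑ i ∈ s, Finsupp.single i 1 : Fin n →₀ ℕ) ≤ m ↔ ∀ l ∈ s, m l ≠ 0 := by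
  rw [Finsupp.le_def]
  refine forall_congr' fun l => ?_
  rw [sum_single_apply]
  split_ifs with h <;> simp [h, Nat.one_le_iff_ne_zero]

theorem mem_complementaryEdgeIdeal {G : SimpleGraph (Fin n)} {f : MvPolynomial (Fin n) K} :
    f ∈ complementaryEdgeIdeal K G ↔
      ∀ m ∈ f.support, ∃ i j, G.Adj i j ∧ ∀ l, l ≠ i → l ≠ j → m l ≠ 0 := by
  have : complementaryEdgeIdeal K G = Ideal.span ((fun s => monomial s (1 : K)) ''
      {a | ∃ i j, G.Adj i j ∧
        a = ∑ l ∈ Finset.univ \ ({i, j} : Finset (Fin n)), Finsupp.single l 1}) := by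
    unfold complementaryEdgeIdeal
    congr 1
    ext u
    simp only [Set.mem_ofPred_eq, Set.mem_image, prod_X_eq_monomial]
    constructor
    · rintro ⟨i, j, h, rfl⟩
      exact ⟨_, ⟨i, j, h, rfl⟩, rfl⟩
    · rintro ⟨_, ⟨i, j, h, rfl⟩, rfl⟩
      exact ⟨i, j, h, rfl⟩
  rw [this, mem_ideal_span_monomial_image]
  refine forall₂_congr fun m _ => ?_
  constructor
  · rintro ⟨_, ⟨i, j, h, rfl⟩, hle⟩
    rw [sum_single_le_iff] at hle
    exact ⟨i, j, h, fun l h1 h2 => hle l (by simp [h1, h2])⟩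
  · rintro ⟨i, j, h, hle⟩
    refine ⟨_, ⟨i, j, h, rfl⟩, (sum_single_le_iff _ _).2 fun l hl => ?_⟩
    simp only [Finset.mem_sdiff, Finset.mem_univ, true_and, Finset.mem_insert,
      Finset.mem_singleton, not_or] at hl
    exact hle l hl.1 hl.2

theorem mem_monomialPrime {F : Finset (Fin n)} {f : MvPolynomial (Fin n) K} :
    f ∈ monomialPrime K F ↔ ∀ m ∈ f.support, ∃ i ∈ F, m i ≠ 0 := by
  have : monomialPrime K F = Ideal.span (X '' (F : Set (Fin n))) := by
    unfold monomialPrime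
    congr 1
    ext u
    simp [eq_comm]
  rw [this, mem_ideal_span_X_image]
  simp

theorem X_mem_monomialPrime {F : Finset (Fin n)} {i : Fin n} (hi : i ∈ F) :
    (X i : MvPolynomial (Fin n) K) ∈ monomialPrime K F :=
  Ideal.subset_span ⟨i, hi, rfl⟩

/-- `P_F` is prime, being the kernel of the endomorphism that kills the variables in `F`. -/
theorem isPrime_monomialPrime (F : Finset (Fin n)) : (monomialPrime K F).IsPrime := by
  classical
  let φ : MvPolynomial (Fin n) K →ₐ[K] MvPolynomial (Fin n) K :=
    aeval fun i => if i ∈ F then 0 else X i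
  have hφ : (Ideal.Quotient.mkₐ K (monomialPrime K F)).comp φ =
      Ideal.Quotient.mkₐ K (monomialPrime K F) := by
    ext i
    by_cases hi : i ∈ F
    · have := Ideal.Quotient.eq_zero_iff_mem.2 (X_mem_monomialPrime (K := K) hi)
      simp [φ, hi, this]
    · simp [φ, hi]
  have : monomialPrime K F = RingHom.ker φ := by
    apply le_antisymm
    · refine Ideal.span_le.2 ?_
      rintro _ ⟨i, hi, rfl⟩
      simp [φ, hi]
    · intro f hf
      have h := DFunLike.congr_fun hφ f
      rw [RingHom.mem_ker] at hf
      rw [AlgHom.comp_apply, hf, map_zero] at h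
      exact Ideal.Quotient.eq_zero_iff_mem.1 h.symm
  rw [this]
  exact RingHom.ker_isPrime _

theorem monomialPrime_le_degreeIdeal (F : Finset (Fin n)) :
    monomialPrime K F ≤ degreeIdeal K F 1 := by
  intro f hf
  rw [mem_monomialPrime] at hf
  rw [mem_degreeIdeal]
  intro m hm
  obtain ⟨i, hi, h⟩ := hf m hm
  exact (Nat.one_le_iff_ne_zero.2 h).trans
    (Finset.single_le_sum (f := fun i => m i) (fun _ _ => Nat.zero_le _) hi)

theorem monomial_mem_monomialPrime_pow {F : Finset (Fin n)} {a : Fin n →₀ ℕ} {k : ℕ}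
    (h : k ≤ ∑ i ∈ F, a i) : monomial a (1 : K) ∈ monomialPrime K F ^ k := by
  classical
  apply Ideal.pow_le_pow_right h
  rw [monomial_eq, C_1, one_mul, Finsupp.prod_fintype _ _ (by simp),
    ← Finset.prod_mul_prod_compl F, ← Finset.prod_pow_eq_pow_sum]
  exact Ideal.mul_mem_right _ _
    (Ideal.prod_mem_prod fun i hi => Ideal.pow_mem_pow (X_mem_monomialPrime hi) _)

/-- A polynomial lies in an ideal as soon as its monomials do. -/
theorem mem_of_monomial_mem {I : Ideal (MvPolynomial (Fin n) K)} {f : MvPolynomial (Fin n) K}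
    (h : ∀ m ∈ f.support, monomial m (1 : K) ∈ I) : f ∈ I := by
  rw [f.as_sum]
  refine I.sum_mem fun m hm => ?_
  have := I.mul_mem_left (C (f.coeff m)) (h m hm)
  rwa [C_mul_monomial, mul_one] at this

/-! ### Associated primes and symbolic powers -/

/-- `F` is a minimal nonface of `G`, the graph being regarded as a simplicial complex whose facets
are its edges: `F` lies in no edge, but `F.erase i` lies in an edge for every `i ∈ F`. Such sets
are the isolated vertices, the pairs of non-isolated non-adjacent vertices and the triangles. -/
structure IsMinimalNonface (G : SimpleGraph (Fin n)) (F : Finset (Fin n)) : Prop where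
  not_subset : ∀ i j, G.Adj i j → ¬ F ⊆ {i, j}
  erase_subset : ∀ l ∈ F, ∃ i j, G.Adj i j ∧ F.erase l ⊆ {i, j}

/-- Every associated prime is an ideal quotient `I : f`; as `I` is squarefree, testing on a monomial
of `f` outside `I` shows that `F` is a minimal nonface. -/
theorem isMinimalNonface_of_mem_associatedPrimes {G : SimpleGraph (Fin n)} {F : Finset (Fin n)}
    (h : monomialPrime K F ∈ associatedPrimes (MvPolynomial (Fin n) K)
      (MvPolynomial (Fin n) K ⧸ complementaryEdgeIdeal K G)) : IsMinimalNonface G F := by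
  classical
  rw [AssociatedPrimes.mem_iff, isAssociatedPrime_iff] at h
  obtain ⟨hp, x, hx⟩ := h
  obtain ⟨f, rfl⟩ := Ideal.Quotient.mk_surjective x
  have key : ∀ g, g ∈ monomialPrime K F ↔ g * f ∈ complementaryEdgeIdeal K G := by
    intro g
    rw [hx, Submodule.mem_colon_singleton, Submodule.mem_bot, ← Ideal.Quotient.eq_zero_iff_mem,
      map_mul]
    rfl
  have hf : f ∉ complementaryEdgeIdeal K G := by
    intro hf
    exact hp.ne_top ((Ideal.eq_top_iff_one _).2 ((key 1).2 (by simpa using hf)))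
  have hle : ∀ i j, G.Adj i j → ¬ F ⊆ {i, j} := by
    intro i j hij hF
    have h1 : (monomial (∑ l ∈ Finset.univ \ ({i, j} : Finset (Fin n)), Finsupp.single l 1) 1 :
        MvPolynomial (Fin n) K) ∈ monomialPrime K F := by
      rw [key, ← prod_X_eq_monomial]
      exact Ideal.mul_mem_right _ _ (Ideal.subset_span ⟨i, j, hij, rfl⟩)
    rw [mem_monomialPrime] at h1
    obtain ⟨l, hl, hl'⟩ := h1 (∑ l ∈ Finset.univ \ ({i, j} : Finset (Fin n)), Finsupp.single l 1)
      (by rw [support_monomial, if_neg one_ne_zero]; exact Finset.mem_singleton_self _)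
    rw [sum_single_apply] at hl'
    simp [hF hl] at hl'
  rw [mem_complementaryEdgeIdeal] at hf
  push Not at hf
  obtain ⟨m, hm, hmI⟩ := hf
  refine ⟨hle, fun l hl => ?_⟩
  have h2 : ∀ l ∈ F, ∃ i j, G.Adj i j ∧
      ∀ t, t ≠ i → t ≠ j → (Finsupp.single l 1 + m : Fin n →₀ ℕ) t ≠ 0 := by
    intro l hl
    refine mem_complementaryEdgeIdeal.1 ((key (X l)).1 (X_mem_monomialPrime hl)) _ ?_
    rw [mem_support_iff, coeff_X_mul]
    exact mem_support_iff.1 hm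
  have h3 : ∀ l ∈ F, m l = 0 := by
    intro l hl
    by_contra hml
    obtain ⟨i, j, hij, h⟩ := h2 l hl
    obtain ⟨t, h1, h2, h3⟩ := hmI i j hij
    have := h t h1 h2
    rw [Finsupp.add_apply, h3, Finsupp.single_apply] at this
    split_ifs at this with hlt
    · subst hlt; exact hml h3
    · exact this rfl
  obtain ⟨i, j, hij, h⟩ := h2 l hl
  refine ⟨i, j, hij, fun t ht => ?_⟩
  obtain ⟨htl, htF⟩ := Finset.mem_erase.1 ht
  by_contra hc
  simp only [Finset.mem_insert, Finset.mem_singleton, not_or] at hc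
  apply h t hc.1 hc.2
  rw [Finsupp.add_apply, h3 t htF, Finsupp.single_apply, if_neg (Ne.symm htl)]

/-- For a minimal nonface `F`, the prime `P_F` is the ideal quotient of `I_c(G)` by the product of
the variables outside `F`. -/
theorem IsMinimalNonface.mem_associatedPrimes {G : SimpleGraph (Fin n)} {F : Finset (Fin n)}
    (h : IsMinimalNonface G F) : monomialPrime K F ∈ associatedPrimes (MvPolynomial (Fin n) K)
      (MvPolynomial (Fin n) K ⧸ complementaryEdgeIdeal K G) := by
  classical
  rw [AssociatedPrimes.mem_iff, isAssociatedPrime_iff]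
  refine ⟨isPrime_monomialPrime F,
    Ideal.Quotient.mk _ (monomial (∑ l ∈ Finset.univ \ F, Finsupp.single l 1) 1), ?_⟩
  ext g
  have h0 : g ∈ Submodule.colon (⊥ : Submodule (MvPolynomial (Fin n) K) _)
      {Ideal.Quotient.mk (complementaryEdgeIdeal K G)
        (monomial (∑ l ∈ Finset.univ \ F, Finsupp.single l 1) 1)} ↔
      g * monomial (∑ l ∈ Finset.univ \ F, Finsupp.single l 1) 1 ∈
        complementaryEdgeIdeal K G := by
    rw [Submodule.mem_colon_singleton, Submodule.mem_bot, ← Ideal.Quotient.eq_zero_iff_mem,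
      map_mul]
    rfl
  rw [h0]
  constructor
  · suffices hs : monomialPrime K F ≤ Submodule.colon (complementaryEdgeIdeal K G)
        {monomial (∑ l ∈ Finset.univ \ F, Finsupp.single l 1) 1} by
      intro hg
      simpa [Submodule.mem_colon_singleton] using hs hg
    refine Ideal.span_le.2 ?_
    rintro _ ⟨l, hl, rfl⟩
    obtain ⟨i, j, hij, hsub⟩ := h.erase_subset l hl
    rw [SetLike.mem_coe, Submodule.mem_colon_singleton, smul_eq_mul, mem_complementaryEdgeIdeal]
    intro m hm
    refine ⟨i, j, hij, fun t hi hj => ?_⟩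
    rw [X, monomial_mul, support_monomial] at hm
    simp only [mul_one, one_ne_zero, if_false, Finset.mem_singleton] at hm
    rw [hm, Finsupp.add_apply, sum_single_apply, Finsupp.single_apply]
    by_cases htl : l = t
    · simp [htl]
    · have : t ∉ F := fun htF => by
        have := hsub (Finset.mem_erase.2 ⟨Ne.symm htl, htF⟩)
        simp_all
      simp [this]
  · intro hg
    rw [mem_complementaryEdgeIdeal] at hg
    rw [mem_monomialPrime]
    intro m hm
    obtain ⟨i, j, hij, hm'⟩ := hg (m + ∑ l ∈ Finset.univ \ F, Finsupp.single l 1) (by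
      rw [mem_support_iff, coeff_mul_monomial, mul_one]
      exact mem_support_iff.1 hm)
    obtain ⟨l, hl, hl'⟩ := Finset.not_subset.1 (h.not_subset i j hij)
    simp only [Finset.mem_insert, Finset.mem_singleton, not_or] at hl'
    refine ⟨l, hl, ?_⟩
    have := hm' l hl'.1 hl'.2
    rw [Finsupp.add_apply, sum_single_apply] at this
    simpa [hl] using this

/-- Monomial localization and extension are ring maps, so they commute with powers, and on the
generators of `I_c(G)` they delete the variables outside `F`. -/
theorem extendIdeal_monomialLocalization (G : SimpleGraph (Fin n)) (F : Finset (Fin n)) (k : ℕ) :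
    extendIdeal F (monomialLocalization (complementaryEdgeIdeal K G ^ k) F) =
      Ideal.span {u | ∃ i j : Fin n, G.Adj i j ∧ u = ∏ l ∈ F \ ({i, j} : Finset (Fin n)),
        (X l : MvPolynomial (Fin n) K)} ^ k := by
  classical
  unfold extendIdeal monomialLocalization
  rw [Ideal.map_pow, Ideal.map_pow, complementaryEdgeIdeal, Ideal.map_span, Ideal.map_span,
    Set.image_image]
  congr 2
  have himg : ∀ i j : Fin n,
      ((rename (R := K) (Subtype.val : {i : Fin n // i ∈ F} → Fin n)) (localizationMap K F
        (∏ l ∈ Finset.univ \ ({i, j} : Finset (Fin n)), X l))) =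
      ∏ l ∈ F \ ({i, j} : Finset (Fin n)), X l := by
    intro i j
    rw [map_prod, map_prod]
    have h1 : ∀ l : Fin n, (rename (R := K) (Subtype.val : {i : Fin n // i ∈ F} → Fin n))
        (localizationMap K F (X l)) = if l ∈ F then X l else 1 := by
      intro l
      unfold localizationMap
      by_cases hl : l ∈ F <;> simp [hl]
    simp_rw [h1]
    rw [Finset.prod_ite, Finset.prod_const_one, mul_one]
    congr 1
    ext l
    simp [and_comm]
  ext u
  constructor
  · rintro ⟨_, ⟨i, j, h, rfl⟩, rfl⟩
    exact ⟨i, j, h, himg i j⟩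
  · rintro ⟨i, j, h, rfl⟩
    exact ⟨_, ⟨i, j, h, rfl⟩, himg i j⟩

theorem IsMinimalNonface.extendIdeal_monomialLocalization {G : SimpleGraph (Fin n)}
    {F : Finset (Fin n)} (h : IsMinimalNonface G F) (k : ℕ) :
    extendIdeal F (monomialLocalization (complementaryEdgeIdeal K G ^ k) F) =
      monomialPrime K F ^ k := by
  rw [ComplementaryEdgeIdeal.extendIdeal_monomialLocalization]
  congr 1
  apply le_antisymm
  · refine Ideal.span_le.2 ?_
    rintro _ ⟨i, j, hij, rfl⟩
    obtain ⟨l, hl, hl'⟩ := Finset.not_subset.1 (h.not_subset i j hij)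
    exact Ideal.mem_of_dvd _ (Finset.dvd_prod_of_mem _ (Finset.mem_sdiff.2 ⟨hl, hl'⟩))
      (X_mem_monomialPrime hl)
  · refine Ideal.span_le.2 ?_
    rintro _ ⟨l, hl, rfl⟩
    obtain ⟨i, j, hij, hsub⟩ := h.erase_subset l hl
    have hF : F \ {i, j} = {l} := by
      obtain ⟨t, ht, ht'⟩ := Finset.not_subset.1 (h.not_subset i j hij)
      have htl : t = l := by
        by_contra hne
        exact ht' (hsub (Finset.mem_erase.2 ⟨hne, ht⟩))
      subst htl
      ext s
      simp only [Finset.mem_sdiff, Finset.mem_singleton]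
      constructor
      · rintro ⟨hs, hs'⟩
        by_contra hne
        exact hs' (hsub (Finset.mem_erase.2 ⟨hne, hs⟩))
      · rintro rfl
        exact ⟨ht, ht'⟩
    exact Ideal.subset_span ⟨i, j, hij, by rw [hF, Finset.prod_singleton]⟩

theorem pow_le_symbolicPower (G : SimpleGraph (Fin n)) (k : ℕ) :
    complementaryEdgeIdeal K G ^ k ≤ symbolicPower (complementaryEdgeIdeal K G) k := by
  refine le_iInf₂ fun F _ => ?_
  rw [extendIdeal_monomialLocalization]
  refine Ideal.pow_right_mono (Ideal.span_le.2 ?_) k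
  rintro _ ⟨i, j, hij, rfl⟩
  exact Ideal.mem_of_dvd _ (Finset.prod_dvd_prod_of_subset _ _ _
    (Finset.sdiff_subset_sdiff (Finset.subset_univ F) subset_rfl))
    (Ideal.subset_span ⟨i, j, hij, rfl⟩)

/-- The symbolic power is spanned by the monomials whose degree in the variables of each minimal
nonface is at least `k`, so equality of powers is a statement about these monomials. -/
theorem pow_eq_symbolicPower_iff (G : SimpleGraph (Fin n)) (k : ℕ) :
    complementaryEdgeIdeal K G ^ k = symbolicPower (complementaryEdgeIdeal K G) k ↔
      ∀ a : Fin n →₀ ℕ, (∀ F, IsMinimalNonface G F → k ≤ ∑ i ∈ F, a i) →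
        monomial a (1 : K) ∈ complementaryEdgeIdeal K G ^ k := by
  constructor
  · intro h a ha
    rw [h]
    unfold symbolicPower
    simp only [Ideal.mem_iInf]
    intro F hF
    have hF' := isMinimalNonface_of_mem_associatedPrimes hF
    rw [hF'.extendIdeal_monomialLocalization]
    exact monomial_mem_monomialPrime_pow (ha F hF')
  · intro h
    refine le_antisymm (pow_le_symbolicPower G k) fun f hf => ?_
    refine mem_of_monomial_mem fun m hm => h m fun F hF => ?_
    unfold symbolicPower at hf
    simp only [Ideal.mem_iInf] at hf
    have h1 := hf F hF.mem_associatedPrimes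
    rw [hF.extendIdeal_monomialLocalization] at h1
    have h2 := degreeIdeal_pow_le F 1 k (Ideal.pow_right_mono (monomialPrime_le_degreeIdeal F) k h1)
    rw [mul_one, mem_degreeIdeal] at h2
    exact h2 m hm

/-! ### Minimal nonfaces -/

theorem isMinimalNonface_singleton {G : SimpleGraph (Fin n)} (hG : ∃ i j, G.Adj i j) {v : Fin n}
    (hv : ∀ w, ¬ G.Adj v w) : IsMinimalNonface G {v} := by
  refine ⟨fun i j hij h => ?_, fun l hl => ?_⟩
  · have hv' := h (Finset.mem_singleton_self v)
    simp only [Finset.mem_insert, Finset.mem_singleton] at hv'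
    rcases hv' with rfl | rfl
    · exact hv _ hij
    · exact hv _ hij.symm
  · obtain ⟨i, j, hij⟩ := hG
    rw [Finset.mem_singleton] at hl
    subst hl
    exact ⟨i, j, hij, by simp⟩

theorem isMinimalNonface_pair {G : SimpleGraph (Fin n)} {u v u' v' : Fin n} (huv : u ≠ v)
    (h : ¬ G.Adj u v) (hu : G.Adj u u') (hv : G.Adj v v') : IsMinimalNonface G {u, v} := by
  refine ⟨fun i j hij hs => ?_, fun l hl => ?_⟩
  · have h1 : u ∈ ({i, j} : Finset (Fin n)) := hs (by simp)
    have h2 : v ∈ ({i, j} : Finset (Fin n)) := hs (by simp)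
    have := hij.symm
    simp only [Finset.mem_insert, Finset.mem_singleton] at h1 h2
    rcases h1 with rfl | rfl <;> rcases h2 with rfl | rfl <;> contradiction
  · simp only [Finset.mem_insert, Finset.mem_singleton] at hl
    rcases hl with rfl | rfl
    · refine ⟨_, _, hv, fun t ht => ?_⟩
      simp only [Finset.mem_erase, Finset.mem_insert, Finset.mem_singleton] at ht ⊢
      tauto
    · refine ⟨_, _, hu, fun t ht => ?_⟩
      simp only [Finset.mem_erase, Finset.mem_insert, Finset.mem_singleton] at ht ⊢
      tauto

theorem isMinimalNonface_triangle {G : SimpleGraph (Fin n)} {u v w : Fin n} (huv : G.Adj u v)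
    (hvw : G.Adj v w) (huw : G.Adj u w) : IsMinimalNonface G {u, v, w} := by
  refine ⟨fun i j hij hs => ?_, fun l hl => ?_⟩
  · have h := Finset.card_le_card hs
    rw [Finset.card_eq_three.2 ⟨u, v, w, huv.ne, huw.ne, hvw.ne, rfl⟩] at h
    have := h.trans Finset.card_le_two
    omega
  · simp only [Finset.mem_insert, Finset.mem_singleton] at hl
    rcases hl with rfl | rfl | rfl
    · refine ⟨_, _, hvw, fun t ht => ?_⟩
      simp only [Finset.mem_erase, Finset.mem_insert, Finset.mem_singleton] at ht ⊢
      tauto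
    · refine ⟨_, _, huw, fun t ht => ?_⟩
      simp only [Finset.mem_erase, Finset.mem_insert, Finset.mem_singleton] at ht ⊢
      tauto
    · refine ⟨_, _, huv, fun t ht => ?_⟩
      simp only [Finset.mem_erase, Finset.mem_insert, Finset.mem_singleton] at ht ⊢
      tauto

theorem IsMinimalNonface.classification {G : SimpleGraph (Fin n)} (hG : ∃ i j, G.Adj i j)
    {F : Finset (Fin n)} (h : IsMinimalNonface G F) :
    (∃ v, F = {v} ∧ ∀ w, ¬ G.Adj v w) ∨
    (∃ u v, F = {u, v} ∧ u ≠ v ∧ ¬ G.Adj u v ∧ (∃ w, G.Adj u w) ∧ ∃ w, G.Adj v w) ∨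
    (∃ u v w, F = {u, v, w} ∧ G.Adj u v ∧ G.Adj v w ∧ G.Adj u w) := by
  have hadj : ∀ u v, u ≠ v → ∀ i j, G.Adj i j → u ∈ ({i, j} : Finset (Fin n)) →
      v ∈ ({i, j} : Finset (Fin n)) → G.Adj u v := by
    intro u v huv i j hij hu hv
    have := hij.symm
    simp only [Finset.mem_insert, Finset.mem_singleton] at hu hv
    rcases hu with rfl | rfl <;> rcases hv with rfl | rfl <;> first | assumption | contradiction
  have hnon : ∀ u, ∀ i j, G.Adj i j → u ∈ ({i, j} : Finset (Fin n)) → ∃ w, G.Adj u w := by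
    intro u i j hij hu
    simp only [Finset.mem_insert, Finset.mem_singleton] at hu
    rcases hu with rfl | rfl
    · exact ⟨_, hij⟩
    · exact ⟨_, hij.symm⟩
  have hcard : F.card ≤ 3 := by
    rcases F.eq_empty_or_nonempty with rfl | ⟨l, hl⟩
    · simp
    · obtain ⟨i, j, hij, hs⟩ := h.erase_subset l hl
      have := (Finset.card_le_card hs).trans Finset.card_le_two
      rw [Finset.card_erase_of_mem hl] at this
      omega
  rcases (by omega : F.card = 0 ∨ F.card = 1 ∨ F.card = 2 ∨ F.card = 3) with h0 | h1 | h2 | h3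
  · obtain ⟨i, j, hij⟩ := hG
    rw [Finset.card_eq_zero] at h0
    exact absurd (h0 ▸ Finset.empty_subset _) (h.not_subset i j hij)
  · obtain ⟨v, rfl⟩ := Finset.card_eq_one.1 h1
    refine Or.inl ⟨v, rfl, fun w hvw => h.not_subset v w hvw (by simp)⟩
  · obtain ⟨u, v, huv, rfl⟩ := Finset.card_eq_two.1 h2
    refine Or.inr (Or.inl ⟨u, v, rfl, huv, fun hadj => h.not_subset u v hadj subset_rfl, ?_, ?_⟩)
    · obtain ⟨i, j, hij, hs⟩ := h.erase_subset v (by simp)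
      exact hnon u i j hij (hs (by simp [huv]))
    · obtain ⟨i, j, hij, hs⟩ := h.erase_subset u (by simp)
      exact hnon v i j hij (hs (by simp [huv.symm]))
  · obtain ⟨u, v, w, huv, huw, hvw, rfl⟩ := Finset.card_eq_three.1 h3
    refine Or.inr (Or.inr ⟨u, v, w, rfl, ?_, ?_, ?_⟩)
    · obtain ⟨i, j, hij, hs⟩ := h.erase_subset w (by simp)
      exact hadj u v huv i j hij (hs (by simp [huw])) (hs (by simp [hvw]))
    · obtain ⟨i, j, hij, hs⟩ := h.erase_subset u (by simp)
      exact hadj v w hvw i j hij (hs (by simp [huv.symm])) (hs (by simp [huw.symm]))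
    · obtain ⟨i, j, hij, hs⟩ := h.erase_subset v (by simp)
      exact hadj u w huw i j hij (hs (by simp [huv])) (hs (by simp [hvw.symm]))

/-! ### Obstructions to equality -/

/-- If every edge misses at least `r` vertices of `T`, then `I_c(G) ^ k ⊆ P_T ^ (k * r)`. A monomial
of smaller `T`-degree that lies in the symbolic power separates the two ideals. -/
theorem pow_ne_symbolicPower {G : SimpleGraph (Fin n)} (hG : ∃ i j, G.Adj i j) {k r : ℕ}
    {T : Finset (Fin n)} (hr : ∀ i j, G.Adj i j → r ≤ (T \ {i, j}).card) (a : Fin n → ℕ)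
    (isolated : ∀ v, (∀ w, ¬ G.Adj v w) → k ≤ a v)
    (pair : ∀ u v, u ≠ v → ¬ G.Adj u v → k ≤ a u + a v)
    (triangle : ∀ u v w, G.Adj u v → G.Adj v w → G.Adj u w → k ≤ a u + a v + a w)
    (hlt : ∑ i ∈ T, a i < k * r) :
    complementaryEdgeIdeal K G ^ k ≠ symbolicPower (complementaryEdgeIdeal K G) k := by
  intro heq
  have h := (pow_eq_symbolicPower_iff G k).1 heq (Finsupp.equivFunOnFinite.symm a) (by
    intro F hF
    rcases hF.classification hG with ⟨v, rfl, hv⟩ | ⟨u, v, rfl, huv, hadj, -⟩ |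
      ⟨u, v, w, rfl, huv, hvw, huw⟩
    · simpa using isolated v hv
    · rw [Finset.sum_pair huv]
      exact pair u v huv hadj
    · rw [Finset.sum_insert (by simp [huv.ne, huw.ne]), Finset.sum_pair hvw.ne, ← add_assoc]
      exact triangle u v w huv hvw huw)
  have hle : complementaryEdgeIdeal K G ≤ degreeIdeal K T r := by
    intro f hf
    rw [mem_complementaryEdgeIdeal] at hf
    rw [mem_degreeIdeal]
    intro m hm
    obtain ⟨i, j, hij, hm'⟩ := hf m hm
    calc r ≤ (T \ {i, j}).card := hr i j hij
      _ = ∑ l ∈ T \ {i, j}, 1 := by simp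
      _ ≤ ∑ l ∈ T \ {i, j}, m l := Finset.sum_le_sum fun l hl => by
          simp only [Finset.mem_sdiff, Finset.mem_insert, Finset.mem_singleton, not_or] at hl
          exact Nat.one_le_iff_ne_zero.2 (hm' l hl.2.1 hl.2.2)
      _ ≤ ∑ l ∈ T, m l := Finset.sum_le_sum_of_subset Finset.sdiff_subset
  have h2 := degreeIdeal_pow_le T r k (Ideal.pow_right_mono hle k h)
  rw [monomial_mem_degreeIdeal] at h2
  exact absurd h2 (not_le.2 hlt)

theorem card_sub_two_le_card_sdiff (T : Finset (Fin n)) (i j : Fin n) :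
    T.card - 2 ≤ (T \ {i, j}).card :=
  (Nat.sub_le_sub_left Finset.card_le_two _).trans (Finset.le_card_sdiff _ _)

/-- Five non-isolated vertices obstruct equality: the exponent is about `k / 2` on each of them,
rounded down on two adjacent ones and up on the others, and `k` elsewhere. -/
theorem pow_ne_symbolicPower_of_five {G : SimpleGraph (Fin n)} {k : ℕ} (hk : 2 ≤ k)
    {p q r s t : Fin n} (hpq : G.Adj p q) (hr : ∃ w, G.Adj r w) (hs : ∃ w, G.Adj s w)
    (ht : ∃ w, G.Adj t w) (hrp : r ≠ p) (hrq : r ≠ q) (hsp : s ≠ p) (hsq : s ≠ q) (hsr : s ≠ r)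
    (htp : t ≠ p) (htq : t ≠ q) (htr : t ≠ r) (hts : t ≠ s) :
    complementaryEdgeIdeal K G ^ k ≠ symbolicPower (complementaryEdgeIdeal K G) k := by
  have hqp := hpq.ne.symm
  let a : Fin n → ℕ := fun l => if l = p ∨ l = q then k / 2 else
    if l = r ∨ l = s ∨ l = t then k - k / 2 else k
  have hge : ∀ l, l ≠ p → l ≠ q → k - k / 2 ≤ a l := by
    intro l h1 h2
    simp only [a, h1, h2, or_self, if_false]
    split_ifs <;> omega
  have hge' : ∀ l, k / 2 ≤ a l := by
    intro l
    simp only [a]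
    split_ifs <;> omega
  have key : ∀ u v, u ≠ p → u ≠ q → k ≤ a u + a v := by
    intro u v h1 h2
    have := hge u h1 h2
    have := hge' v
    omega
  refine pow_ne_symbolicPower ⟨p, q, hpq⟩ (T := {p, q, r, s, t}) (r := 3) (fun i j _ => ?_) a
    (fun v hv => ?_) (fun u v huv hadj => ?_) (fun u v w huv hvw huw => ?_) ?_
  · refine le_trans (le_of_eq ?_) (card_sub_two_le_card_sdiff _ i j)
    simp [hqp.symm, hrp.symm, hrq.symm, hsp.symm, hsq.symm, hsr.symm, htp.symm, htq.symm,
      htr.symm, hts.symm]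
  · have h1 : v ≠ p := by rintro rfl; exact hv _ hpq
    have h2 : v ≠ q := by rintro rfl; exact hv _ hpq.symm
    have h3 : v ≠ r := by rintro rfl; exact hr.elim hv
    have h4 : v ≠ s := by rintro rfl; exact hs.elim hv
    have h5 : v ≠ t := by rintro rfl; exact ht.elim hv
    simp [a, h1, h2, h3, h4, h5]
  · by_cases h1 : u ≠ p ∧ u ≠ q
    · exact key u v h1.1 h1.2
    · rw [add_comm]
      -- `u` is `p` or `q`, and `v` cannot be the other one, as these two are adjacent
      refine key v u ?_ ?_
      · rintro rfl
        exact hadj (by grind [hpq.symm])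
      · rintro rfl
        exact hadj (by grind)
  · have h3 : (u ≠ p ∧ u ≠ q) ∨ (v ≠ p ∧ v ≠ q) ∨ (w ≠ p ∧ w ≠ q) := by
      have := huv.ne
      have := hvw.ne
      have := huw.ne
      grind
    rcases h3 with h | h | h
    · have := key u v h.1 h.2; omega
    · have := key v w h.1 h.2; omega
    · have := key w u h.1 h.2; omega
  · have : ∑ i ∈ ({p, q, r, s, t} : Finset (Fin n)), a i =
        k / 2 + (k / 2 + ((k - k / 2) + ((k - k / 2) + (k - k / 2)))) := by
      rw [Finset.sum_insert, Finset.sum_insert, Finset.sum_insert, Finset.sum_pair hts.symm]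
      · simp [a, hrp, hrq, hsp, hsq, htp, htq]
      all_goals simp [hqp.symm, hrp.symm, hrq.symm, hsp.symm, hsq.symm, hsr.symm, htp.symm,
        htq.symm, htr.symm]
    omega

/-- A triangle with a further neighbour `s` of its vertex `p` obstructs equality: the exponent is
`k` reduced by `2 * ⌊k / 2⌋` at `p`, by `⌈k / 2⌉` at `q` and `r`, and by `⌊k / 2⌋` at `s`. -/
theorem pow_ne_symbolicPower_of_triangle {G : SimpleGraph (Fin n)} {k : ℕ} (hk : 2 ≤ k)
    {p q r s : Fin n} (hpq : G.Adj p q) (hqr : G.Adj q r) (hpr : G.Adj p r) (hps : G.Adj p s)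
    (hsq : s ≠ q) (hsr : s ≠ r) :
    complementaryEdgeIdeal K G ^ k ≠ symbolicPower (complementaryEdgeIdeal K G) k := by
  have hqp := hpq.ne.symm
  have hrp := hpr.ne.symm
  have hsp := hps.ne.symm
  have hrq := hqr.ne.symm
  let a : Fin n → ℕ := fun l => if l = p then k - 2 * (k / 2) else
    if l = q ∨ l = r then k / 2 else if l = s then k - k / 2 else k
  have hap : a p = k - 2 * (k / 2) := by simp [a]
  have hfar : ∀ l, ¬ G.Adj p l → p ≠ l → k ≤ a l := by
    intro l hl hpl
    have h2 : l ≠ q := by rintro rfl; exact hl hpq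
    have h3 : l ≠ r := by rintro rfl; exact hl hpr
    have h4 : l ≠ s := by rintro rfl; exact hl hps
    simp [a, hpl.symm, h2, h3, h4]
  have hge : ∀ l, l ≠ p → l ≠ q → l ≠ r → k - k / 2 ≤ a l := by
    intro l h1 h2 h3
    simp only [a, h1, h2, h3, or_self, if_false]
    split_ifs <;> omega
  have hge' : ∀ l, l ≠ p → k / 2 ≤ a l := by
    intro l h
    simp only [a, h, if_false]
    split_ifs <;> omega
  have key : ∀ u v, u ≠ p → u ≠ q → u ≠ r → v ≠ p → k ≤ a u + a v := by
    intro u v h1 h2 h3 h4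
    have := hge u h1 h2 h3
    have := hge' v h4
    omega
  refine pow_ne_symbolicPower ⟨p, q, hpq⟩ (T := {p, q, r, s}) (r := 2) (fun i j _ => ?_) a
    (fun v hv => ?_) (fun u v huv hadj => ?_) (fun u v w huv hvw huw => ?_) ?_
  · refine le_trans (le_of_eq ?_) (card_sub_two_le_card_sdiff _ i j)
    simp [hqp.symm, hrp.symm, hrq.symm, hsp.symm, hsq.symm, hsr.symm]
  · refine hfar v (fun h => hv p h.symm) ?_
    rintro rfl
    exact hv q hpq
  · by_cases hu : u = p
    · subst hu
      have := hfar v hadj huv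
      omega
    by_cases hv : v = p
    · subst hv
      have := hfar u (fun h => hadj h.symm) (Ne.symm huv)
      omega
    by_cases h1 : u ≠ q ∧ u ≠ r
    · exact key u v hu h1.1 h1.2 hv
    · rw [add_comm]
      refine key v u hv ?_ ?_ hu
      · rintro rfl
        exact hadj (by grind [hqr.symm])
      · rintro rfl
        exact hadj (by grind)
  · have huv' := huv.ne
    have hvw' := hvw.ne
    have huw' := huw.ne
    by_cases hu : u = p
    · subst hu
      have := hge' v huv'.symm
      have := hge' w huw'.symm
      omega
    by_cases hv : v = p
    · subst hv
      have := hge' u hu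
      have := hge' w hvw'.symm
      omega
    by_cases hw : w = p
    · subst hw
      have := hge' u hu
      have := hge' v hv
      omega
    have h3 : (u ≠ q ∧ u ≠ r) ∨ (v ≠ q ∧ v ≠ r) ∨ (w ≠ q ∧ w ≠ r) := by grind
    rcases h3 with h | h | h
    · have := key u v hu h.1 h.2 hv; omega
    · have := key v w hv h.1 h.2 hw; omega
    · have := key w u hw h.1 h.2 hu; omega
  · have : ∑ i ∈ ({p, q, r, s} : Finset (Fin n)), a i =
        (k - 2 * (k / 2)) + (k / 2 + (k / 2 + (k - k / 2))) := by
      rw [Finset.sum_insert, Finset.sum_insert, Finset.sum_pair hsr.symm]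
      · simp [a, hqp, hrp, hsp, hsq, hsr]
      all_goals simp [hqp.symm, hrp.symm, hrq.symm, hsp.symm, hsq.symm]
    omega

/-- Three independent non-isolated vertices obstruct equality: each edge contains at most one of
them, while the exponents on them can be `⌊k / 2⌋`, `⌈k / 2⌉`, `⌈k / 2⌉`. -/
theorem pow_ne_symbolicPower_of_independent {G : SimpleGraph (Fin n)} {k : ℕ} (hk : 2 ≤ k)
    {p q r : Fin n} (hp : ∃ w, G.Adj p w) (hq : ∃ w, G.Adj q w) (hr : ∃ w, G.Adj r w)
    (hqp : q ≠ p) (hrp : r ≠ p) (hrq : r ≠ q)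
    (hpq : ¬ G.Adj p q) (hpr : ¬ G.Adj p r) (hqr : ¬ G.Adj q r) :
    complementaryEdgeIdeal K G ^ k ≠ symbolicPower (complementaryEdgeIdeal K G) k := by
  let a : Fin n → ℕ := fun l => if l = p then k / 2 else
    if l = q ∨ l = r then k - k / 2 else k
  have hge : ∀ l, l ≠ p → k - k / 2 ≤ a l := by
    intro l h1
    simp only [a, h1, if_false]
    split_ifs <;> omega
  have hge' : ∀ l, k / 2 ≤ a l := by
    intro l
    simp only [a]
    split_ifs <;> omega
  have key : ∀ u v, u ≠ v → k ≤ a u + a v := by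
    intro u v huv
    by_cases hu : u = p
    · have := hge v (hu ▸ huv.symm)
      have := hge' u
      omega
    · have := hge u hu
      have := hge' v
      omega
  have hcard : ({p, q, r} : Finset (Fin n)).card = 3 :=
    Finset.card_eq_three.2 ⟨p, q, r, hqp.symm, hrp.symm, hrq.symm, rfl⟩
  refine pow_ne_symbolicPower (hp.imp' (fun _ => p) fun w hw => ⟨w, hw⟩) (T := {p, q, r}) (r := 2)
    (fun i j hij => ?_) a (fun v hv => ?_) (fun u v huv _ => key u v huv)
    (fun u v w huv hvw huw => (key u v huv.ne).trans (Nat.le_add_right _ _)) ?_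
  · have hnot : ¬ (i ∈ ({p, q, r} : Finset (Fin n)) ∧ j ∈ ({p, q, r} : Finset (Fin n))) := by
      rintro ⟨hi, hj⟩
      have hji := hij.symm
      simp only [Finset.mem_insert, Finset.mem_singleton] at hi hj
      rcases hi with rfl | rfl | rfl <;> rcases hj with rfl | rfl | rfl <;>
        first | contradiction | exact G.loopless.irrefl _ hij
    have hdel : ∀ x y : Fin n, x ∉ ({p, q, r} : Finset (Fin n)) →
        2 ≤ (({p, q, r} : Finset (Fin n)) \ {x, y}).card := by
      intro x y hx
      rw [Finset.sdiff_insert, Finset.erase_eq_of_notMem (by simp [hx])]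
      have := Finset.le_card_sdiff {y} ({p, q, r} : Finset (Fin n))
      simpa [hcard] using this
    by_cases hi : i ∈ ({p, q, r} : Finset (Fin n))
    · rw [Finset.pair_comm i j]
      exact hdel j i fun hj => hnot ⟨hi, hj⟩
    · exact hdel i j hi
  · have h1 : v ≠ p := by rintro rfl; exact hp.elim hv
    have h2 : v ≠ q := by rintro rfl; exact hq.elim hv
    have h3 : v ≠ r := by rintro rfl; exact hr.elim hv
    simp [a, h1, h2, h3]
  · have : ∑ i ∈ ({p, q, r} : Finset (Fin n)), a i = k / 2 + ((k - k / 2) + (k - k / 2)) := by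
      rw [Finset.sum_insert (by simp [hqp.symm, hrp.symm]), Finset.sum_pair hrq.symm]
      simp [a, hqp, hrp]
    omega

end

/-! ### The exceptional graphs -/

theorem isoUpToIsolated_iff {V W : Type*} [Finite V] {G : SimpleGraph V} {H : SimpleGraph W} :
    IsoUpToIsolated G H ↔ ∃ f : W → V, Function.Injective f ∧
      (∀ i j, G.Adj (f i) (f j) ↔ H.Adj i j) ∧ ∀ v w, G.Adj v w → v ∈ Set.range f := by
  classical
  constructor
  · rintro ⟨m, ⟨e⟩⟩
    refine ⟨fun i => e.symm (Sum.inl i), fun i j h => Sum.inl_injective (e.symm.injective h),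
      fun i j => by rw [e.symm.map_adj_iff, sum_adj_inl], fun v w hvw => ?_⟩
    have h := e.map_adj_iff.2 hvw
    rcases hv : e v with i | i
    · exact ⟨i, by simp [← hv]⟩
    · rcases hw : e w with j | j <;> rw [hv, hw] at h <;> simp at h
  · rintro ⟨f, hf, hadj, hiso⟩
    let e : W ⊕ Fin (Nat.card ((Set.range f)ᶜ : Set V)) ≃ V :=
      ((Equiv.ofInjective f hf).sumCongr (Finite.equivFin _).symm).trans (Equiv.Set.sumCompl _)
    have hl : ∀ i, e (Sum.inl i) = f i := fun _ => rfl
    have hr : ∀ i, e (Sum.inr i) ∉ Set.range f := fun i =>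
      ((Finite.equivFin ((Set.range f)ᶜ : Set V)).symm i).2
    refine ⟨_, ⟨(⟨e, ?_⟩ : (H ⊕g ⊥) ≃g G).symm⟩⟩
    rintro (i | i) (j | j)
    · rw [hl, hl, hadj, sum_adj_inl]
    · simpa using fun h : G.Adj _ _ => hr j (hiso _ _ h.symm)
    · simpa using fun h : G.Adj _ _ => hr i (hiso _ _ h)
    · exact iff_of_false (fun h => hr i (hiso _ _ h)) (fun h => h.elim)

section

variable {n : ℕ} {G : SimpleGraph (Fin n)}

theorem isoUpToIsolated_K2_iff : IsoUpToIsolated G (completeGraph (Fin 2)) ↔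
    ∃ p q, G.Adj p q ∧ ∀ v w, G.Adj v w → v = p ∨ v = q := by
  rw [isoUpToIsolated_iff]
  constructor
  · rintro ⟨f, hf, hadj, hiso⟩
    refine ⟨f 0, f 1, (hadj 0 1).2 (by simp), fun v w h => ?_⟩
    obtain ⟨i, rfl⟩ := hiso v w h
    fin_cases i <;> simp
  · rintro ⟨p, q, h, hiso⟩
    refine ⟨![p, q], ?_, ?_, fun v w hvw => ?_⟩
    · intro i j; fin_cases i <;> fin_cases j <;> simp [h.ne, h.ne.symm]
    · intro i j; fin_cases i <;> fin_cases j <;> simp [h, h.symm]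
    · rcases hiso v w hvw with rfl | rfl
      exacts [⟨0, rfl⟩, ⟨1, rfl⟩]

theorem isoUpToIsolated_K3_iff : IsoUpToIsolated G (completeGraph (Fin 3)) ↔
    ∃ p q r, G.Adj p q ∧ G.Adj q r ∧ G.Adj p r ∧
      ∀ v w, G.Adj v w → v = p ∨ v = q ∨ v = r := by
  rw [isoUpToIsolated_iff]
  constructor
  · rintro ⟨f, hf, hadj, hiso⟩
    refine ⟨f 0, f 1, f 2, (hadj 0 1).2 (by simp), (hadj 1 2).2 (by simp), (hadj 0 2).2 (by simp),
      fun v w h => ?_⟩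
    obtain ⟨i, rfl⟩ := hiso v w h
    fin_cases i <;> simp
  · rintro ⟨p, q, r, h1, h2, h3, hiso⟩
    refine ⟨![p, q, r], ?_, ?_, fun v w hvw => ?_⟩
    · intro i j
      fin_cases i <;> fin_cases j <;> simp [h1.ne, h1.ne.symm, h2.ne, h2.ne.symm, h3.ne, h3.ne.symm]
    · intro i j; fin_cases i <;> fin_cases j <;> simp [h1, h1.symm, h2, h2.symm, h3, h3.symm]
    · rcases hiso v w hvw with rfl | rfl | rfl
      exacts [⟨0, rfl⟩, ⟨1, rfl⟩, ⟨2, rfl⟩]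

theorem isoUpToIsolated_P3_iff : IsoUpToIsolated G (pathGraph 3) ↔
    ∃ p q r, G.Adj p q ∧ G.Adj q r ∧ p ≠ r ∧ ¬ G.Adj p r ∧
      ∀ v w, G.Adj v w → v = p ∨ v = q ∨ v = r := by
  rw [isoUpToIsolated_iff]
  constructor
  · rintro ⟨f, hf, hadj, hiso⟩
    refine ⟨f 0, f 1, f 2, (hadj 0 1).2 (by simp [pathGraph_adj]),
      (hadj 1 2).2 (by simp [pathGraph_adj]), hf.ne (by decide),
      mt (hadj 0 2).1 (by simp [pathGraph_adj]), fun v w h => ?_⟩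
    obtain ⟨i, rfl⟩ := hiso v w h
    fin_cases i <;> simp
  · rintro ⟨p, q, r, h1, h2, hne, h3, hiso⟩
    have h3' : ¬ G.Adj r p := fun h => h3 h.symm
    refine ⟨![p, q, r], ?_, ?_, fun v w hvw => ?_⟩
    · intro i j
      fin_cases i <;> fin_cases j <;> simp [h1.ne, h1.ne.symm, h2.ne, h2.ne.symm, hne, hne.symm]
    · intro i j
      fin_cases i <;> fin_cases j <;> simp [h1, h1.symm, h2, h2.symm, h3, h3', pathGraph_adj]
    · rcases hiso v w hvw with rfl | rfl | rfl
      exacts [⟨0, rfl⟩, ⟨1, rfl⟩, ⟨2, rfl⟩]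

theorem isoUpToIsolated_2K2_iff :
    IsoUpToIsolated G (completeGraph (Fin 2) ⊕g completeGraph (Fin 2)) ↔
    ∃ p q r s, G.Adj p q ∧ G.Adj r s ∧ p ≠ r ∧ p ≠ s ∧ q ≠ r ∧ q ≠ s ∧
      ¬ G.Adj p r ∧ ¬ G.Adj p s ∧ ¬ G.Adj q r ∧ ¬ G.Adj q s ∧
      ∀ v w, G.Adj v w → v = p ∨ v = q ∨ v = r ∨ v = s := by
  rw [isoUpToIsolated_iff]
  constructor
  · rintro ⟨f, hf, hadj, hiso⟩
    refine ⟨f (.inl 0), f (.inl 1), f (.inr 0), f (.inr 1), (hadj _ _).2 (by simp),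
      (hadj _ _).2 (by simp), hf.ne (by decide), hf.ne (by decide), hf.ne (by decide),
      hf.ne (by decide), mt (hadj _ _).1 (by simp), mt (hadj _ _).1 (by simp),
      mt (hadj _ _).1 (by simp), mt (hadj _ _).1 (by simp), fun v w h => ?_⟩
    obtain ⟨i, rfl⟩ := hiso v w h
    rcases i with i | i <;> fin_cases i <;> simp
  · rintro ⟨p, q, r, s, h1, h2, n1, n2, n3, n4, h3, h4, h5, h6, hiso⟩
    refine ⟨Sum.elim ![p, q] ![r, s], ?_, ?_, fun v w hvw => ?_⟩
    · rintro (i | i) (j | j) <;> fin_cases i <;> fin_cases j <;>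
        simp [h1.ne, h1.ne.symm, h2.ne, h2.ne.symm, n1, n1.symm, n2, n2.symm, n3, n3.symm, n4,
          n4.symm]
    · rintro (i | i) (j | j) <;> fin_cases i <;> fin_cases j <;>
        simp [h1, h1.symm, h2, h2.symm, h3, h4, h5, h6, mt G.adj_symm h3, mt G.adj_symm h4,
          mt G.adj_symm h5, mt G.adj_symm h6]
    · rcases hiso v w hvw with rfl | rfl | rfl | rfl
      exacts [⟨.inl 0, rfl⟩, ⟨.inl 1, rfl⟩, ⟨.inr 0, rfl⟩, ⟨.inr 1, rfl⟩]

theorem isoUpToIsolated_P4_iff : IsoUpToIsolated G (pathGraph 4) ↔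
    ∃ p q r s, G.Adj p q ∧ G.Adj q r ∧ G.Adj r s ∧ p ≠ r ∧ p ≠ s ∧ q ≠ s ∧
      ¬ G.Adj p r ∧ ¬ G.Adj p s ∧ ¬ G.Adj q s ∧
      ∀ v w, G.Adj v w → v = p ∨ v = q ∨ v = r ∨ v = s := by
  rw [isoUpToIsolated_iff]
  constructor
  · rintro ⟨f, hf, hadj, hiso⟩
    refine ⟨f 0, f 1, f 2, f 3, (hadj _ _).2 (by simp [pathGraph_adj]),
      (hadj _ _).2 (by simp [pathGraph_adj]), (hadj _ _).2 (by simp [pathGraph_adj]),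
      hf.ne (by decide), hf.ne (by decide), hf.ne (by decide),
      mt (hadj _ _).1 (by simp [pathGraph_adj]), mt (hadj _ _).1 (by simp [pathGraph_adj]),
      mt (hadj _ _).1 (by simp [pathGraph_adj]), fun v w h => ?_⟩
    obtain ⟨i, rfl⟩ := hiso v w h
    fin_cases i <;> simp
  · rintro ⟨p, q, r, s, h1, h2, h3, n1, n2, n3, h4, h5, h6, hiso⟩
    refine ⟨![p, q, r, s], ?_, ?_, fun v w hvw => ?_⟩
    · intro i j
      fin_cases i <;> fin_cases j <;>
        simp [h1.ne, h1.ne.symm, h2.ne, h2.ne.symm, h3.ne, h3.ne.symm, n1, n1.symm, n2, n2.symm,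
          n3, n3.symm]
    · intro i j
      fin_cases i <;> fin_cases j <;>
        simp [h1, h1.symm, h2, h2.symm, h3, h3.symm, h4, h5, h6, mt G.adj_symm h4,
          mt G.adj_symm h5, mt G.adj_symm h6, pathGraph_adj]
    · rcases hiso v w hvw with rfl | rfl | rfl | rfl
      exacts [⟨0, rfl⟩, ⟨1, rfl⟩, ⟨2, rfl⟩, ⟨3, rfl⟩]

theorem isoUpToIsolated_C4_iff : IsoUpToIsolated G (cycleGraph 4) ↔
    ∃ p q r s, G.Adj p q ∧ G.Adj q r ∧ G.Adj r s ∧ G.Adj p s ∧ p ≠ r ∧ q ≠ s ∧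
      ¬ G.Adj p r ∧ ¬ G.Adj q s ∧
      ∀ v w, G.Adj v w → v = p ∨ v = q ∨ v = r ∨ v = s := by
  rw [isoUpToIsolated_iff]
  constructor
  · rintro ⟨f, hf, hadj, hiso⟩
    refine ⟨f 0, f 1, f 2, f 3, (hadj _ _).2 (by rw [cycleGraph_adj]; decide),
      (hadj _ _).2 (by rw [cycleGraph_adj]; decide), (hadj _ _).2 (by rw [cycleGraph_adj]; decide),
      (hadj _ _).2 (by rw [cycleGraph_adj]; decide), hf.ne (by decide), hf.ne (by decide),
      mt (hadj _ _).1 (by rw [cycleGraph_adj]; decide),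
      mt (hadj _ _).1 (by rw [cycleGraph_adj]; decide), fun v w h => ?_⟩
    obtain ⟨i, rfl⟩ := hiso v w h
    fin_cases i <;> simp
  · rintro ⟨p, q, r, s, h1, h2, h3, h4, n1, n2, h5, h6, hiso⟩
    refine ⟨![p, q, r, s], ?_, ?_, fun v w hvw => ?_⟩
    · intro i j
      fin_cases i <;> fin_cases j <;>
        simp [h1.ne, h1.ne.symm, h2.ne, h2.ne.symm, h3.ne, h3.ne.symm, h4.ne, h4.ne.symm, n1,
          n1.symm, n2, n2.symm]
    · intro i j
      rw [cycleGraph_adj]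
      fin_cases i <;> fin_cases j <;>
        simp [h1, h1.symm, h2, h2.symm, h3, h3.symm, h4, h4.symm, h5, h6, mt G.adj_symm h5,
          mt G.adj_symm h6] <;> decide
    · rcases hiso v w hvw with rfl | rfl | rfl | rfl
      exacts [⟨0, rfl⟩, ⟨1, rfl⟩, ⟨2, rfl⟩, ⟨3, rfl⟩]

end

section

variable {K : Type*} [Field K] {n : ℕ}

/-- A monomial lies in `I_c(G) ^ k` if it is divisible by a product of `k` generators. The product
takes the generator of the edge `{u t, v t}` with multiplicity `x t`; at an isolated vertex its
exponent is `k`. -/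
theorem monomial_mem_pow {G : SimpleGraph (Fin n)} {m k : ℕ} (u v : Fin m → Fin n)
    (huv : ∀ t, G.Adj (u t) (v t)) (x : Fin m → ℕ) (hx : ∑ t, x t = k) (a : Fin n →₀ ℕ)
    (hiso : ∀ l, (∀ w, ¬ G.Adj l w) → k ≤ a l)
    (h : ∀ l w, G.Adj l w → ∑ t, (if l = u t ∨ l = v t then 0 else x t) ≤ a l) :
    monomial a (1 : K) ∈ complementaryEdgeIdeal K G ^ k := by
  subst hx
  have hmem : ∏ t, (∏ l ∈ Finset.univ \ ({u t, v t} : Finset (Fin n)),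
      (X l : MvPolynomial (Fin n) K)) ^ x t ∈ complementaryEdgeIdeal K G ^ ∑ t, x t := by
    rw [← Finset.prod_pow_eq_pow_sum]
    refine Ideal.prod_mem_prod fun t _ => Ideal.pow_mem_pow ?_ _
    exact Ideal.subset_span ⟨u t, v t, huv t, rfl⟩
  refine Ideal.mem_of_dvd _ ?_ hmem
  simp_rw [prod_X_eq_monomial, monomial_pow, one_pow]
  rw [← monomial_sum_one, monomial_dvd_monomial]
  refine ⟨Or.inr ?_, dvd_rfl⟩
  rw [Finsupp.le_def]
  intro l
  have hl : (∑ t, x t • ∑ l ∈ Finset.univ \ ({u t, v t} : Finset (Fin n)),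
      (Finsupp.single l 1 : Fin n →₀ ℕ)) l = ∑ t, (if l = u t ∨ l = v t then 0 else x t) := by
    rw [Finsupp.finsetSum_apply]
    refine Finset.sum_congr rfl fun t _ => ?_
    rw [Finsupp.smul_apply, sum_single_apply]
    by_cases hc : l = u t ∨ l = v t <;> simp [hc]
  rw [hl]
  by_cases hw : ∃ w, G.Adj l w
  · obtain ⟨w, hw⟩ := hw
    exact h l w hw
  · push Not at hw
    refine le_trans (Finset.sum_le_sum fun t _ => ?_) (hiso l hw)
    split_ifs <;> simp

/-- To prove equality it suffices to treat the monomials whose exponents satisfy the inequalities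
given by isolated vertices, non-adjacent pairs and triangles. -/
theorem pow_eq_symbolicPower_of_forall {G : SimpleGraph (Fin n)} (hG : ∃ i j, G.Adj i j) {k : ℕ}
    (h : ∀ a : Fin n →₀ ℕ, (∀ v, (∀ w, ¬ G.Adj v w) → k ≤ a v) →
      (∀ u v u' v', u ≠ v → ¬ G.Adj u v → G.Adj u u' → G.Adj v v' → k ≤ a u + a v) →
      (∀ u v w, G.Adj u v → G.Adj v w → G.Adj u w → k ≤ a u + a v + a w) →
      monomial a (1 : K) ∈ complementaryEdgeIdeal K G ^ k) :
    complementaryEdgeIdeal K G ^ k = symbolicPower (complementaryEdgeIdeal K G) k := by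
  refine (pow_eq_symbolicPower_iff G k).2 fun a ha => h a ?_ ?_ ?_
  · intro v hv
    simpa using ha _ (isMinimalNonface_singleton hG hv)
  · intro u v u' v' huv hadj hu hv
    simpa [Finset.sum_pair huv] using ha _ (isMinimalNonface_pair huv hadj hu hv)
  · intro u v w huv hvw huw
    have := ha _ (isMinimalNonface_triangle huv hvw huw)
    rwa [Finset.sum_insert (by simp [huv.ne, huw.ne]), Finset.sum_pair hvw.ne, ← add_assoc] at this

/-- For each exceptional graph the inequalities allow explicit edge multiplicities. -/
theorem pow_eq_symbolicPower_of_exceptional {G : SimpleGraph (Fin n)} (hG : ∃ i j, G.Adj i j)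
    (h : IsoUpToIsolated G (completeGraph (Fin 2)) ∨
      IsoUpToIsolated G (completeGraph (Fin 3)) ∨
      IsoUpToIsolated G (pathGraph 3) ∨
      IsoUpToIsolated G (completeGraph (Fin 2) ⊕g completeGraph (Fin 2)) ∨
      IsoUpToIsolated G (pathGraph 4) ∨
      IsoUpToIsolated G (cycleGraph 4)) (k : ℕ) :
    complementaryEdgeIdeal K G ^ k = symbolicPower (complementaryEdgeIdeal K G) k := by
  refine pow_eq_symbolicPower_of_forall hG fun a hiso pair tri => ?_
  rw [isoUpToIsolated_K2_iff, isoUpToIsolated_K3_iff, isoUpToIsolated_P3_iff,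
    isoUpToIsolated_2K2_iff, isoUpToIsolated_P4_iff, isoUpToIsolated_C4_iff] at h
  rcases h with ⟨p, q, h1, hv⟩ | ⟨p, q, r, h1, h2, h3, hv⟩ | ⟨p, q, r, h1, h2, n1, h3, hv⟩ |
    ⟨p, q, r, s, h1, h2, n1, n2, n3, n4, h3, h4, h5, h6, hv⟩ |
    ⟨p, q, r, s, h1, h2, h3, n1, n2, n3, h4, h5, h6, hv⟩ |
    ⟨p, q, r, s, h1, h2, h3, h4, n1, n2, h5, h6, hv⟩
  · refine monomial_mem_pow ![p] ![q] (by simp [h1]) ![k] (by simp) a hiso fun l w hl => ?_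
    rcases hv l w hl with rfl | rfl <;> simp
  · -- the multiplicity of each edge is bounded by the exponent of the opposite vertex
    obtain ⟨x, y, z, hx, hy, hz, hsum⟩ : ∃ x y z, x ≤ a p ∧ y ≤ a q ∧ z ≤ a r ∧ x + y + z = k :=
      ⟨min (a p) k, min (a q) (k - min (a p) k), k - min (a p) k - min (a q) (k - min (a p) k),
        by omega, by omega, by have := tri p q r h1 h2 h3; omega, by omega⟩
    refine monomial_mem_pow ![q, p, p] ![r, r, q] (fun t => ?_) ![x, y, z] ?_ a hiso
      fun l w hl => ?_
    · fin_cases t <;> simp [h1, h2, h3]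
    · simpa [Fin.sum_univ_three] using hsum
    · rcases hv l w hl with rfl | rfl | rfl <;>
        simp [Fin.sum_univ_three, h1.ne, h1.ne.symm, h2.ne, h2.ne.symm, h3.ne, h3.ne.symm, *]
  · have e1 := pair p r q q n1 h3 h1 h2.symm
    refine monomial_mem_pow ![q, p] ![r, q] (fun t => ?_) ![min (a p) k, k - min (a p) k] ?_ a hiso
      fun l w hl => ?_
    · fin_cases t <;> simp [h1, h2]
    · simp
    · rcases hv l w hl with rfl | rfl | rfl <;>
        simp [Fin.sum_univ_two, h1.ne, h1.ne.symm, h2.ne, h2.ne.symm, n1, n1.symm]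
      omega
  · have e1 := pair p r q s n1 h3 h1 h2
    have e2 := pair p s q r n2 h4 h1 h2.symm
    have e3 := pair q r p s n3 h5 h1.symm h2
    have e4 := pair q s p r n4 h6 h1.symm h2.symm
    refine monomial_mem_pow ![p, r] ![q, s] (fun t => ?_)
      ![k - min (min (a p) (a q)) k, min (min (a p) (a q)) k] ?_ a hiso fun l w hl => ?_
    · fin_cases t <;> simp [h1, h2]
    · simp
    · rcases hv l w hl with rfl | rfl | rfl | rfl <;>
        simp [Fin.sum_univ_two, h1.ne, h1.ne.symm, h2.ne, h2.ne.symm, n1, n1.symm, n2, n2.symm,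
          n3, n3.symm, n4, n4.symm] <;> omega
  · have e1 := pair p r q q n1 h4 h1 h2.symm
    have e2 := pair p s q r n2 h5 h1 h3.symm
    have e3 := pair q s p r n3 h6 h1.symm h3.symm
    -- the end edges occur just often enough for the end vertices
    refine monomial_mem_pow ![p, q, r] ![q, r, s] (fun t => ?_)
      ![k - a p, k - (k - a p) - (k - a s), k - a s] ?_ a hiso fun l w hl => ?_
    · fin_cases t <;> simp [h1, h2, h3]
    · simp [Fin.sum_univ_three]; omega
    · rcases hv l w hl with rfl | rfl | rfl | rfl <;>
        simp [Fin.sum_univ_three, h1.ne, h1.ne.symm, h2.ne, h2.ne.symm, h3.ne, h3.ne.symm, n1,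
          n1.symm, n2, n2.symm, n3, n3.symm] <;> omega
  · have e1 := pair p r q q n1 h5 h1 h2.symm
    have e2 := pair q s p p n2 h6 h1.symm h4.symm
    -- `p`, `r` are avoided `i`, `k - i` times and `q`, `s` are avoided `j`, `k - j` times
    obtain ⟨i, hi⟩ : ∃ i, i = min (a p) k := ⟨_, rfl⟩
    obtain ⟨j, hj⟩ : ∃ j, j = min (a q) k := ⟨_, rfl⟩
    refine monomial_mem_pow ![p, q, r, p] ![q, r, s, s] (fun t => ?_)
      ![k - max i j, i - min i j, min i j, j - min i j] ?_ a hiso fun l w hl => ?_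
    · fin_cases t <;> simp [h1, h2, h3, h4]
    · simp [Fin.sum_univ_four]; omega
    · rcases hv l w hl with rfl | rfl | rfl | rfl <;>
        simp [Fin.sum_univ_four, h1.ne, h1.ne.symm, h2.ne, h2.ne.symm, h3.ne, h3.ne.symm, h4.ne,
          h4.ne.symm, n1, n1.symm, n2, n2.symm] <;> omega

end

/-! ### Classification -/

section

variable {K : Type*} [Field K] {n : ℕ}

/-- A graph without the three obstructions has at most four non-isolated vertices. If it has four,
then on these it contains neither a triangle nor three independent vertices, which leaves `2K_2`,
`P_4` and `C_4`. -/
theorem exceptional_of_no_obstruction {G : SimpleGraph (Fin n)} (hG : ∃ i j, G.Adj i j)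
    (five : ∀ p q r s t, G.Adj p q → (∃ w, G.Adj r w) → (∃ w, G.Adj s w) → (∃ w, G.Adj t w) →
      r ≠ p → r ≠ q → s ≠ p → s ≠ q → s ≠ r → t ≠ p → t ≠ q → t ≠ r → t = s)
    (triangle : ∀ p q r s, G.Adj p q → G.Adj q r → G.Adj p r → G.Adj p s → s ≠ q → s = r)
    (independent : ∀ p q r, (∃ w, G.Adj p w) → (∃ w, G.Adj q w) → (∃ w, G.Adj r w) →
      q ≠ p → r ≠ p → r ≠ q → ¬ G.Adj p q → ¬ G.Adj p r → G.Adj q r) :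
    IsoUpToIsolated G (completeGraph (Fin 2)) ∨
      IsoUpToIsolated G (completeGraph (Fin 3)) ∨
      IsoUpToIsolated G (pathGraph 3) ∨
      IsoUpToIsolated G (completeGraph (Fin 2) ⊕g completeGraph (Fin 2)) ∨
      IsoUpToIsolated G (pathGraph 4) ∨
      IsoUpToIsolated G (cycleGraph 4) := by
  rw [isoUpToIsolated_K2_iff, isoUpToIsolated_K3_iff, isoUpToIsolated_P3_iff,
    isoUpToIsolated_2K2_iff, isoUpToIsolated_P4_iff, isoUpToIsolated_C4_iff]
  obtain ⟨p, q, pq⟩ := hG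
  by_cases h2 : ∀ v w, G.Adj v w → v = p ∨ v = q
  · exact Or.inl ⟨p, q, pq, h2⟩
  push Not at h2
  obtain ⟨r, r', hr, rp, rq⟩ := h2
  by_cases h3 : ∀ v w, G.Adj v w → v = p ∨ v = q ∨ v = r
  · right
    by_cases pr : G.Adj p r
    · by_cases qr : G.Adj q r
      · exact Or.inl ⟨p, q, r, pq, qr, pr, h3⟩
      · exact Or.inr (Or.inl ⟨q, p, r, pq.symm, pr, rq.symm, qr, fun v w h => by
          have := h3 v w h; tauto⟩)
    · have qr : G.Adj q r := by
        rcases h3 r' r hr.symm with rfl | rfl | rfl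
        · exact absurd hr.symm pr
        · exact hr.symm
        · exact absurd rfl hr.ne
      exact Or.inr (Or.inl ⟨p, q, r, pq, qr, rp.symm, pr, h3⟩)
  push Not at h3
  obtain ⟨s, s', hs, sp, sq, sr⟩ := h3
  have h4 : ∀ v w, G.Adj v w → v = p ∨ v = q ∨ v = r ∨ v = s := by
    intro v w h
    by_contra! hc
    exact hc.2.2.2 (five p q r s v pq ⟨_, hr⟩ ⟨_, hs⟩ ⟨_, h⟩ rp rq sp sq sr hc.1 hc.2.1 hc.2.2.1)
  right; right; right
  have tri : ∀ p q r s, G.Adj p q → G.Adj q r → G.Adj p r → G.Adj p s → s ≠ q → ¬ s ≠ r :=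
    fun p q r s h1 h2 h3 h4 h5 => not_not.2 (triangle p q r s h1 h2 h3 h4 h5)
  by_cases rs : G.Adj r s
  · by_cases pr : G.Adj p r
    · have qr : ¬ G.Adj q r := fun qr => tri r p q s pr.symm pq qr.symm rs sp sq
      have ps : ¬ G.Adj p s := fun ps => tri p r s q pr rs ps pq rq.symm sq.symm
      by_cases qs : G.Adj q s
      · exact Or.inr (Or.inr ⟨p, q, s, r, pq, qs, rs.symm, pr, sp.symm, rq.symm, ps, qr,
          fun v w h => by have := h4 v w h; tauto⟩)
      · exact Or.inr (Or.inl ⟨q, p, r, s, pq.symm, pr, rs, rq.symm, sq.symm, sp.symm, qr, qs, ps,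
          fun v w h => by have := h4 v w h; tauto⟩)
    · by_cases ps : G.Adj p s
      · have qs : ¬ G.Adj q s := fun qs => tri s p q r ps.symm pq qs.symm rs.symm rp rq
        by_cases qr : G.Adj q r
        · exact Or.inr (Or.inr ⟨p, q, r, s, pq, qr, rs, ps, rp.symm, sq.symm, pr, qs, h4⟩)
        · exact Or.inr (Or.inl ⟨q, p, s, r, pq.symm, ps, rs.symm, sq.symm, rq.symm, rp.symm, qs,
            qr, pr, fun v w h => by have := h4 v w h; tauto⟩)
      · by_cases qr : G.Adj q r
        · have qs : ¬ G.Adj q s := fun qs => tri q r s p qr rs qs pq.symm rp.symm sp.symm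
          exact Or.inr (Or.inl ⟨p, q, r, s, pq, qr, rs, rp.symm, sp.symm, sq.symm, pr, ps, qs, h4⟩)
        · by_cases qs : G.Adj q s
          · exact Or.inr (Or.inl ⟨p, q, s, r, pq, qs, rs.symm, sp.symm, rp.symm, rq.symm, ps, pr,
              qr, fun v w h => by have := h4 v w h; tauto⟩)
          · exact Or.inl ⟨p, q, r, s, pq, rs, rp.symm, sp.symm, rq.symm, sq.symm, pr, ps, qr, qs,
              h4⟩
  · have hps : ¬ G.Adj p r → G.Adj p s := fun pr => by
      by_contra ps
      exact rs (independent p r s ⟨_, pq⟩ ⟨_, hr⟩ ⟨_, hs⟩ rp sp sr pr ps)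
    have hqs : ¬ G.Adj q r → G.Adj q s := fun qr => by
      by_contra qs
      exact rs (independent q r s ⟨_, pq.symm⟩ ⟨_, hr⟩ ⟨_, hs⟩ rq sq sr qr qs)
    -- as `r` and `s` are not isolated and not adjacent, each of them is adjacent to `p` or `q`
    have hr' : ¬ G.Adj p r → G.Adj q r := fun pr => by
      rcases h4 r' r hr.symm with rfl | rfl | rfl | rfl
      · exact absurd hr.symm pr
      · exact hr.symm
      · exact absurd rfl hr.ne
      · exact absurd hr rs
    have hs' : ¬ G.Adj p s → G.Adj q s := fun ps => by
      rcases h4 s' s hs.symm with rfl | rfl | rfl | rfl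
      · exact absurd hs.symm ps
      · exact hs.symm
      · exact absurd hs.symm rs
      · exact absurd rfl hs.ne
    by_cases pr : G.Adj p r
    · have qr : ¬ G.Adj q r := fun qr => by
        by_cases ps : G.Adj p s
        · exact tri p q r s pq qr pr ps sq sr
        · exact tri q p r s pq.symm pr qr (hs' ps) sp sr
      have qs := hqs qr
      have ps : ¬ G.Adj p s := fun ps => tri p q s r pq qs ps pr rq sr.symm
      exact Or.inr (Or.inl ⟨r, p, q, s, pr.symm, pq, qs, rq, sr.symm, sp.symm,
        fun h => qr h.symm, rs, ps, fun v w h => by have := h4 v w h; tauto⟩)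
    · have ps := hps pr
      have qr := hr' pr
      have qs : ¬ G.Adj q s := fun qs => tri q p s r pq.symm ps qs qr rp sr.symm
      exact Or.inr (Or.inl ⟨s, p, q, r, ps.symm, pq, qr, sq, sr, rp.symm,
        fun h => qs h.symm, fun h => rs h.symm, pr, fun v w h => by have := h4 v w h; tauto⟩)

theorem exceptional_of_pow_eq_symbolicPower {G : SimpleGraph (Fin n)} (hG : ∃ i j, G.Adj i j)
    {k : ℕ} (hk : 2 ≤ k)
    (h : complementaryEdgeIdeal K G ^ k = symbolicPower (complementaryEdgeIdeal K G) k) :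
    IsoUpToIsolated G (completeGraph (Fin 2)) ∨
      IsoUpToIsolated G (completeGraph (Fin 3)) ∨
      IsoUpToIsolated G (pathGraph 3) ∨
      IsoUpToIsolated G (completeGraph (Fin 2) ⊕g completeGraph (Fin 2)) ∨
      IsoUpToIsolated G (pathGraph 4) ∨
      IsoUpToIsolated G (cycleGraph 4) := by
  refine exceptional_of_no_obstruction hG ?_ ?_ ?_
  · intro p q r s t pq hr hs ht rp rq sp sq sr tp tq tr
    by_contra ts
    exact pow_ne_symbolicPower_of_five hk pq hr hs ht rp rq sp sq sr tp tq tr ts h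
  · intro p q r s pq qr pr ps sq
    by_contra sr
    exact pow_ne_symbolicPower_of_triangle hk pq qr pr ps sq sr h
  · intro p q r hp hq hr qp rp rq pq pr
    by_contra qr
    exact pow_ne_symbolicPower_of_independent hk hp hq hr qp rp rq pq pr qr h

end

end ComplementaryEdgeIdeal

theorem mainTheorem7 (K : Type*) [Field K] (n : ℕ) (G : SimpleGraph (Fin n))
    (hG : ∃ i j : Fin n, G.Adj i j) :
    List.TFAE [
      ∀ k : ℕ, 1 ≤ k →
        ComplementaryEdgeIdeal.complementaryEdgeIdeal K G ^ k =
          ComplementaryEdgeIdeal.symbolicPower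
            (ComplementaryEdgeIdeal.complementaryEdgeIdeal K G) k,
      ∃ k : ℕ, 2 ≤ k ∧
        ComplementaryEdgeIdeal.complementaryEdgeIdeal K G ^ k =
          ComplementaryEdgeIdeal.symbolicPower
            (ComplementaryEdgeIdeal.complementaryEdgeIdeal K G) k,
      ComplementaryEdgeIdeal.IsoUpToIsolated G (completeGraph (Fin 2)) ∨
        ComplementaryEdgeIdeal.IsoUpToIsolated G (completeGraph (Fin 3)) ∨
        ComplementaryEdgeIdeal.IsoUpToIsolated G (pathGraph 3) ∨
        ComplementaryEdgeIdeal.IsoUpToIsolated G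
          (completeGraph (Fin 2) ⊕g completeGraph (Fin 2)) ∨
        ComplementaryEdgeIdeal.IsoUpToIsolated G (pathGraph 4) ∨
        ComplementaryEdgeIdeal.IsoUpToIsolated G (cycleGraph 4)] := by
  tfae_have 1 → 2 := fun h => ⟨2, le_rfl, h 2 one_le_two⟩
  tfae_have 2 → 3 := fun ⟨_, hk, h⟩ =>
    ComplementaryEdgeIdeal.exceptional_of_pow_eq_symbolicPower hG hk h
  tfae_have 3 → 1 := fun h k _ =>
    ComplementaryEdgeIdeal.pow_eq_symbolicPower_of_exceptional hG h k
  tfae_finish
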